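/- Let $N\ge 0$ be an integer and let $S=(s_{j,k})_{j,k=1}^N$ be a real symmetric $N\times N$ matrix whose Frobenius norm $\|S\|=\big(\sum_{j,k=1}^N |s_{j,k}|^2\big)^{1/2}$ satisfies $\|S\|<1$. Let $X=(x_1,\dots,x_N)^T\in\mathbb{C}^N$ (in particular, $X$ may be any vector in $\mathbb{R}^N$). Let $H_n$ be the (physicists') Hermite polynomials, given by $H_0=1$ and $H_{n+1}(x)=2xH_n(x)-H_n'(x)$, equivalently $H_n(x)=(-1)^n e^{x^2}\frac{d^n}{dx^n}e^{-x^2}$. Then $\det(I_N+S)>0$ (so $I_N+S$ is invertible), and $$\det(I_N+S)^{-1/2}\exp\!\left(X^TS(I_N+S)^{-1}X\right)=\sum_{K}\left(\prod_{1\le m\le n\le N}\frac{s_{m,n}^{k_{m,n}}}{2^{k_{m,n}}\,k_{m,n}!}\right)2^{-\operatorname{tr}(K)}H_{k_1}(x_1)\cdots H_{k_N}(x_N).$$ Here the sum is the $\frac{N(N+1)}{2}$-fold sum over all nonnegative integers $k_{m,n}$, $1\le m\le n\le N$; $K=(k_{m,n})_{m,n=1}^N$ is the symmetric matrix with these entries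 ($k_{n,m}=k_{m,n}$), $$\operatorname{tr}(K)=\sum_{j=1}^N k_{j,j},\qquad k_\ell=k_{\ell,\ell}+\sum_{j=1}^N k_{\ell,j}\quad(\ell=1,\dots,N),$$ and the series converges absolutely (equivalently, unconditionally) to the left-hand side. -/

import Mathlib

-- Norms of matrices are Frobenius norms: ‖S‖ ^ 2 = ∑ j, ∑ k, ‖S j k‖ ^ 2.
open scoped Matrix.Norms.Frobenius

namespace KibbleSlepian

/-- The physicists' Hermite polynomials `H_n` (orthogonal for the weight `exp (-x ^ 2)`):
`H_0 = 1` and `H_{n+1} = 2 x H_n - H_n'`, which is Rodrigues' formula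
`H_n(x) = (-1) ^ n * exp (x ^ 2) * (d/dx) ^ n exp (-x ^ 2)` written as a recursion. -/
noncomputable def hermiteH : ℕ → Polynomial ℤ
  | 0 => 1
  | n + 1 => 2 * Polynomial.X * hermiteH n - Polynomial.derivative (hermiteH n)

/-- The index pairs `(m, n)` with `m ≤ n`; there are `N (N + 1) / 2` of them. -/
abbrev UpperPair (N : ℕ) : Type := {p : Fin N × Fin N // p.1 ≤ p.2}

/-- The symmetric matrix `K` of nonnegative integers with the given entries `k_{m,n}`, `m ≤ n`. -/
def symMatrix {N : ℕ} (k : UpperPair N → ℕ) : Matrix (Fin N) (Fin N) ℕ :=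
  Matrix.of fun m n =>
    if h : m ≤ n then k ⟨(m, n), h⟩ else k ⟨(n, m), (not_le.mp h).le⟩

/-- The degree `k_l = k_{l,l} + ∑ j, k_{l,j}` attached to a matrix `K`
(the diagonal entry is counted twice). -/
def rowDegree {N : ℕ} (K : Matrix (Fin N) (Fin N) ℕ) (l : Fin N) : ℕ :=
  K l l + ∑ j, K l j

/-- The term of the multilinear Hermite series that belongs to the exponents `k`. -/
noncomputable def term {N : ℕ} (S : Matrix (Fin N) (Fin N) ℝ) (X : Fin N → ℂ)
    (k : UpperPair N → ℕ) : ℂ :=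
  (∏ p : UpperPair N,
      (S p.1.1 p.1.2 : ℂ) ^ k p / ((2 : ℂ) ^ k p * (Nat.factorial (k p) : ℂ))) *
    ((2 : ℂ) ^ (symMatrix k).trace)⁻¹ *
    ∏ l : Fin N, Polynomial.aeval (X l) (hermiteH (rowDegree (symMatrix k) l))

end KibbleSlepian

/-!
The identity is the Gaussian average of an exponential series.

By `integral_linePoint_pow`, `√π * H_n(x) = ∫ z ^ n * exp (-y ^ 2) dy` with `z = 2 (x + i y)`.
Hence the product `H_{k_1}(x_1) ⋯ H_{k_N}(x_N)` is, up to `π ^ (N / 2)`, the average of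
`∏ l, z_l ^ k_l = ∏ (z_m z_n) ^ k_{m,n}` over the pairs `m ≤ n`, and the terms of the Hermite series
are the averages of the terms in the multinomial expansion of `exp (z ^ T S z / 4)`
(`integral_prod_pairExponent_pow`).

Summation and averaging may be exchanged by dominated convergence
(`hasSum_integral_prod_pairExponent`): by Cauchy-Schwarz, the sum of the norms of the terms is at
most `exp (‖S‖ ∑ l, (|x_l| + |y_l|) ^ 2)` for the Frobenius norm `‖S‖ < 1`, which is integrable
against `exp (-∑ l, y_l ^ 2)`.

The average of `exp (z ^ T S z / 4)` is computed in an orthonormal eigenbasis of `S`, where it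
factors into one-dimensional Gaussian integrals (`integral_cexp_quadratic_form`). The eigenvalues
are at most `‖S‖ < 1` in absolute value (`abs_diagonal_le_norm`), so those of `1 + S` are positive.
-/

namespace KibbleSlepian

open MeasureTheory Complex Matrix

/-! ### Hermite polynomials as Gaussian averages of powers -/

theorem integrable_exp_neg_mul_sq_add_mul_abs {b : ℝ} (hb : 0 < b) (c d : ℝ) :
    Integrable fun y : ℝ => Real.exp (-b * y ^ 2 + c * |y| + d) := by
  have key (c : ℝ) : Integrable fun y : ℝ => Real.exp (-b * y ^ 2 + c * y + d) := by
    refine (integrable_cexp_quadratic (b := b) (by simpa using hb) c d).norm.congr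
      (.of_forall fun y => ?_)
    simp only [norm_exp]
    norm_cast
  refine ((key c).add (key (-c))).mono' (by fun_prop) (.of_forall fun y => ?_)
  rw [Real.norm_of_nonneg (Real.exp_pos _).le, Pi.add_apply]
  rcases abs_cases y with ⟨h, -⟩ | ⟨h, -⟩ <;> rw [h]
  · exact le_add_of_nonneg_right (Real.exp_pos _).le
  · rw [mul_neg, ← neg_mul]
    exact le_add_of_nonneg_left (Real.exp_pos _).le

/-- The point `2 (x + i y)` of the vertical line through `2 x`. Averaging its `n`-th power over `y`
against the weight `exp (-y ^ 2)` gives `H_n(x)`, see `integral_linePoint_pow`. -/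
noncomputable def linePoint (x : ℂ) (y : ℝ) : ℂ := 2 * (x + I * y)

@[fun_prop]
theorem continuous_linePoint (x : ℂ) : Continuous (linePoint x) := by
  unfold linePoint; fun_prop

theorem norm_linePoint_le (x : ℂ) (y : ℝ) : ‖linePoint x y‖ ≤ 2 * (‖x‖ + |y|) := by
  rw [linePoint, norm_mul, RCLike.norm_ofNat]
  gcongr
  refine (norm_add_le _ _).trans ?_
  simp

theorem hasDerivAt_linePoint (x : ℂ) (y : ℝ) : HasDerivAt (linePoint x) (2 * I) y := by
  have h := (((hasDerivAt_id y).ofReal_comp.const_mul I).const_add x).const_mul 2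
  refine (h.congr_of_eventuallyEq (.of_forall fun z => rfl)).congr_deriv ?_
  simp

theorem integrable_linePoint_pow (x : ℂ) (n : ℕ) :
    Integrable fun y : ℝ => linePoint x y ^ n * cexp (-(y : ℂ) ^ 2) := by
  refine ((integrable_exp_neg_mul_sq_add_mul_abs one_pos 2 (2 * ‖x‖)).const_mul
    (n.factorial : ℝ)).mono' (by fun_prop) (.of_forall fun y => ?_)
  have h1 : ‖linePoint x y‖ ^ n ≤ n.factorial * Real.exp (2 * (‖x‖ + |y|)) := by
    have h := Real.pow_div_factorial_le_exp _ (norm_nonneg (linePoint x y)) n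
    rw [div_le_iff₀' (by positivity)] at h
    exact h.trans (by gcongr; exact norm_linePoint_le x y)
  have h2 : ‖cexp (-(y : ℂ) ^ 2)‖ = Real.exp (-y ^ 2) := by
    rw [norm_exp]; norm_cast
  rw [norm_mul, norm_pow, h2]
  calc _ ≤ n.factorial * Real.exp (2 * (‖x‖ + |y|)) * Real.exp (-y ^ 2) := by gcongr
    _ = _ := by rw [mul_assoc, ← Real.exp_add]; ring_nf

theorem integral_exp_neg_sq : ∫ y : ℝ, cexp (-(y : ℂ) ^ 2) = (√Real.pi : ℝ) := by
  have h := integral_gaussian 1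
  rw [div_one] at h
  rw [← h, ← integral_complex_ofReal]
  simp

/-- The Gaussian moments of `linePoint x` satisfy the three-term recurrence of the Hermite
polynomials, because the derivative of `linePoint x y ^ (n + 1) * exp (-y ^ 2)` integrates
to `0`. -/
theorem integral_linePoint_pow_add_two (x : ℂ) (n : ℕ) :
    ∫ y : ℝ, linePoint x y ^ (n + 2) * cexp (-(y : ℂ) ^ 2) =
      2 * x * (∫ y : ℝ, linePoint x y ^ (n + 1) * cexp (-(y : ℂ) ^ 2)) -
        2 * (n + 1) * ∫ y : ℝ, linePoint x y ^ n * cexp (-(y : ℂ) ^ 2) := by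
  have i0 := (integrable_linePoint_pow x n).const_mul (2 * (n + 1) : ℂ)
  have i1 := (integrable_linePoint_pow x (n + 1)).const_mul (2 * x)
  have i2 := integrable_linePoint_pow x (n + 2)
  -- The factor `I` makes the integrand exactly the derivative, `linePoint` having slope `2 * I`.
  have hint : ∫ y : ℝ, I * (linePoint x y ^ (n + 2) * cexp (-(y : ℂ) ^ 2) -
      (2 * x * (linePoint x y ^ (n + 1) * cexp (-(y : ℂ) ^ 2)) -
        2 * (n + 1) * (linePoint x y ^ n * cexp (-(y : ℂ) ^ 2)))) = 0 := by
    refine integral_eq_zero_of_hasDerivAt_of_integrable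
      (f := fun y => linePoint x y ^ (n + 1) * cexp (-(y : ℂ) ^ 2)) (fun y => ?_)
      ((i2.sub (i1.sub i0)).const_mul I) (integrable_linePoint_pow x (n + 1))
    have h := ((hasDerivAt_linePoint x y).pow (n + 1)).mul
      (((hasDerivAt_id y).ofReal_comp.pow 2).neg.cexp)
    refine h.congr_deriv ?_
    simp only [linePoint, id, Pi.pow_apply, Pi.neg_apply]
    push_cast
    -- `ring_nf` leaves the powers `I ^ 2` and `I ^ 3`, which `ring` alone cannot reduce.
    ring_nf
    simp only [I_sq, I_pow_three]
    ring
  have hs := integral_sub i2 (i1.sub i0)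
  simp only [Pi.sub_apply] at hs
  rw [integral_const_mul, mul_eq_zero, or_iff_right I_ne_zero, hs, integral_sub i1 i0,
    integral_const_mul, integral_const_mul] at hint
  exact sub_eq_zero.mp hint

theorem derivative_hermiteH_succ (n : ℕ) :
    Polynomial.derivative (hermiteH (n + 1)) = 2 * (n + 1) * hermiteH n := by
  induction n with
  | zero => simp [hermiteH]
  | succ n ih =>
    rw [hermiteH, ih]
    simp only [Polynomial.derivative_sub, Polynomial.derivative_mul, Polynomial.derivative_X,
      Polynomial.derivative_ofNat, Polynomial.derivative_add, Polynomial.derivative_natCast,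
      Polynomial.derivative_one, ih]
    rw [hermiteH]
    push_cast
    ring

theorem hermiteH_add_two (n : ℕ) :
    hermiteH (n + 2) =
      2 * Polynomial.X * hermiteH (n + 1) - 2 * ((n : Polynomial ℤ) + 1) * hermiteH n := by
  rw [← derivative_hermiteH_succ, hermiteH]

/-- The integral representation `√π * H_n(x) = ∫ (2 (x + i y)) ^ n * exp (-y ^ 2) dy`. -/
theorem integral_linePoint_pow (x : ℂ) (n : ℕ) :
    ∫ y : ℝ, linePoint x y ^ n * cexp (-(y : ℂ) ^ 2) =
      (√Real.pi : ℝ) * Polynomial.aeval x (hermiteH n) := by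
  induction n using Nat.twoStepInduction with
  | zero => simp [hermiteH, integral_exp_neg_sq]
  | one =>
    have hodd : ∫ y : ℝ, (y : ℂ) * cexp (-(y : ℂ) ^ 2) = 0 := by
      have h := integral_neg_eq_self (fun y : ℝ => (y : ℂ) * cexp (-(y : ℂ) ^ 2)) volume
      simp only [ofReal_neg, neg_sq, neg_mul, integral_neg] at h
      exact self_eq_neg.mp h.symm
    have i0 := (integrable_linePoint_pow x 0).const_mul (2 * x)
    have hd : ∫ y : ℝ, (linePoint x y ^ 1 * cexp (-(y : ℂ) ^ 2) -
        2 * x * (linePoint x y ^ 0 * cexp (-(y : ℂ) ^ 2))) = 0 := by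
      rw [← mul_zero (2 * I), ← hodd, ← integral_const_mul]
      congr 1 with y
      simp only [linePoint]
      ring
    rw [integral_sub (integrable_linePoint_pow x 1) i0, integral_const_mul, sub_eq_zero] at hd
    rw [hd]
    simp [hermiteH, integral_exp_neg_sq, map_ofNat]
    ring
  | more n ih0 ih1 =>
    rw [integral_linePoint_pow_add_two, ih0, ih1, hermiteH_add_two]
    simp [map_ofNat]
    ring

/-! ### Multiplying out a finite product of series -/

theorem hasSum_fin_prod {n : ℕ} {f : Fin n → ℕ → ℂ} {a : Fin n → ℂ}
    (h : ∀ i, HasSum (f i) (a i)) :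
    HasSum (fun k : Fin n → ℕ => ∏ i, f i (k i)) (∏ i, a i) := by
  induction n with
  | zero => simp
  | succ n ih =>
    have ht := ih fun i => h i.succ
    have hn := summable_mul_of_summable_norm (h 0).summable.norm ht.summable.norm
    have hm := (h 0).mul ht hn
    rw [← (Fin.consEquiv fun _ : Fin (n + 1) => ℕ).hasSum_iff, Fin.prod_univ_succ]
    convert! hm using 2 with k
    simp [Fin.consEquiv, Fin.prod_univ_succ]

/-- A finite product of unconditionally convergent series may be multiplied out. -/
theorem hasSum_prod_of_hasSum {ι : Type*} [Fintype ι] {f : ι → ℕ → ℂ} {a : ι → ℂ}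
    (h : ∀ i, HasSum (f i) (a i)) :
    HasSum (fun k : ι → ℕ => ∏ i, f i (k i)) (∏ i, a i) := by
  let e := Fintype.equivFin ι
  have hs := hasSum_fin_prod fun j => h (e.symm j)
  rw [e.symm.prod_comp a, ← (e.arrowCongr (Equiv.refl ℕ)).hasSum_iff] at hs
  convert! hs using 2 with k
  rw [Function.comp_apply, ← e.symm.prod_comp]
  simp

/-- The exponential of a finite sum, expanded in all the exponents at once. -/
theorem hasSum_prod_pow_div_factorial {ι : Type*} [Fintype ι] (a : ι → ℂ) :
    HasSum (fun k : ι → ℕ => ∏ i, a i ^ k i / (k i).factorial) (cexp (∑ i, a i)) := by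
  rw [Complex.exp_sum]
  refine hasSum_prod_of_hasSum (f := fun i m => a i ^ m / m.factorial) fun i => ?_
  rw [Complex.exp_eq_exp_ℂ]
  exact NormedSpace.expSeries_div_hasSum_exp (a i)

/-! ### Orthogonal diagonalization and the Frobenius norm -/

/-- The Frobenius norm bounds the quadratic form even after taking absolute values of the entries
(Cauchy-Schwarz over index pairs); the operator norm would not. -/
theorem sum_abs_mul_le_norm {N : ℕ} (S : Matrix (Fin N) (Fin N) ℝ) (a : Fin N → ℝ) :
    ∑ i, ∑ j, |S i j| * (a i * a j) ≤ ‖S‖ * ∑ i, a i ^ 2 := by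
  have h := Real.sum_mul_le_sqrt_mul_sqrt (Finset.univ : Finset (Fin N × Fin N))
    (fun p => |S p.1 p.2|) (fun p => a p.1 * a p.2)
  have h1 : ‖S‖ = √(∑ i, ∑ j, |S i j| ^ 2) := by
    simp [frobenius_norm_def, Real.sqrt_eq_rpow]
  have h2 : ∑ i, a i ^ 2 = √(∑ i, ∑ j, (a i * a j) ^ 2) := by
    simp only [mul_pow, ← Finset.sum_mul_sum]
    rw [Real.sqrt_mul_self (by positivity)]
  rw [h1, h2]
  simpa only [Fintype.sum_prod_type] using h

/-- Substituting `U *ᵥ v` in the bilinear (not sesquilinear) form of `A`. -/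
theorem dotProduct_mulVec_conj {N : ℕ} {R : Type*} [CommRing R] (A U : Matrix (Fin N) (Fin N) R)
    (v : Fin N → R) : (U *ᵥ v) ⬝ᵥ (A *ᵥ (U *ᵥ v)) = v ⬝ᵥ ((Uᵀ * A * U) *ᵥ v) := by
  rw [dotProduct_comm, dotProduct_mulVec, ← mulVec_transpose, dotProduct_comm,
    mulVec_mulVec, mulVec_mulVec, Matrix.mul_assoc]

theorem dotProduct_diagonal_mulVec {N : ℕ} {R : Type*} [CommRing R] (d v : Fin N → R) :
    v ⬝ᵥ (diagonal d *ᵥ v) = ∑ i, d i * v i ^ 2 := by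
  simp only [dotProduct, mulVec_diagonal]
  exact Finset.sum_congr rfl fun i _ => by ring

theorem exists_orthogonal_diagonalization {N : ℕ} {S : Matrix (Fin N) (Fin N) ℝ}
    (hS : S.IsSymm) :
    ∃ (U : Matrix (Fin N) (Fin N) ℝ) (d : Fin N → ℝ), Uᵀ * U = 1 ∧ S = U * diagonal d * Uᵀ := by
  have hH : S.IsHermitian := by rwa [IsHermitian, conjTranspose_eq_transpose_of_trivial]
  refine ⟨hH.eigenvectorUnitary, hH.eigenvalues, ?_, ?_⟩
  · have h := Unitary.coe_star_mul_self hH.eigenvectorUnitary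
    rwa [star_eq_conjTranspose, conjTranspose_eq_transpose_of_trivial] at h
  · have h := hH.spectral_theorem
    rw [Unitary.conjStarAlgAut_apply, star_eq_conjTranspose,
      conjTranspose_eq_transpose_of_trivial] at h
    exact h

/-- An eigenvalue is the value of the quadratic form at a unit eigenvector, a column of `U`. -/
theorem abs_diagonal_le_norm {N : ℕ} {S U : Matrix (Fin N) (Fin N) ℝ} {d : Fin N → ℝ}
    (hU : Uᵀ * U = 1) (hS : S = U * diagonal d * Uᵀ) (j : Fin N) : |d j| ≤ ‖S‖ := by
  have hd : Uᵀ * S * U = diagonal d := by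
    rw [hS, show Uᵀ * (U * diagonal d * Uᵀ) * U = (Uᵀ * U) * diagonal d * (Uᵀ * U) by
      simp only [Matrix.mul_assoc], hU, one_mul, mul_one]
  have hunit : ∑ i, |U i j| ^ 2 = 1 := by
    have := congrFun (congrFun hU j) j
    simpa [mul_apply, ← pow_two] using this
  have he : d j = ∑ k, ∑ i, U i j * S i k * U k j := by
    have := congrFun (congrFun hd j) j
    simpa [mul_apply, Finset.sum_mul] using this.symm
  calc |d j| ≤ ∑ k, ∑ i, |U i j * S i k * U k j| := by
        rw [he]
        exact (Finset.abs_sum_le_sum_abs _ _).trans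
          (Finset.sum_le_sum fun k _ => Finset.abs_sum_le_sum_abs _ _)
    _ = ∑ i, ∑ k, |S i k| * (|U i j| * |U k j|) := by
        rw [Finset.sum_comm]
        simp only [abs_mul]
        exact Finset.sum_congr rfl fun i _ => Finset.sum_congr rfl fun k _ => by ring
    _ ≤ ‖S‖ := by
        simpa only [hunit, mul_one] using sum_abs_mul_le_norm S fun i => |U i j|

/-! ### The Gaussian integral of a quadratic form -/

theorem measurePreserving_mulVec_of_orthogonal {N : ℕ} {U : Matrix (Fin N) (Fin N) ℝ}
    (hU : Uᵀ * U = 1) : MeasurePreserving (fun w : Fin N → ℝ => U *ᵥ w) := by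
  have hdet : U.det * U.det = 1 := by
    simpa using congrArg det hU
  have habs : |U.det⁻¹| = 1 := by
    rw [abs_inv, inv_eq_one]
    rcases mul_self_eq_one_iff.mp hdet with h | h <;> simp [h]
  refine ⟨by fun_prop, ?_⟩
  have h := Real.map_matrix_volume_pi_eq_smul_volume_pi (M := U) (by
    rintro h0; simp [h0] at hdet)
  rw [habs, ENNReal.ofReal_one, one_smul] at h
  exact h

theorem integral_cexp_linePoint_sq {l : ℝ} (hl : 0 < 1 + l) (V : ℂ) :
    ∫ w : ℝ, cexp (l * linePoint V w ^ 2 / 4) * cexp (-(w : ℂ) ^ 2) =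
      (√Real.pi : ℝ) * (((1 + l) ^ (-(1 / 2) : ℝ) : ℝ) : ℂ) *
        cexp ((l / (1 + l) : ℝ) * V ^ 2) := by
  have hne : (1 + l : ℂ) ≠ 0 := by exact_mod_cast hl.ne'
  have h := integral_cexp_quadratic (b := -(1 + l : ℂ)) (by simpa using neg_lt_iff_pos_add.mpr hl)
    (2 * I * l * V) (l * V ^ 2)
  have hc : ((Real.pi : ℂ) / - -(1 + l : ℂ)) ^ (1 / 2 : ℂ) =
      (√Real.pi : ℝ) * (((1 + l) ^ (-(1 / 2) : ℝ) : ℝ) : ℂ) := by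
    rw [Real.rpow_neg hl.le, Real.sqrt_eq_rpow, ← ofReal_mul, ← div_eq_mul_inv,
      ← Real.div_rpow Real.pi_pos.le hl.le, ofReal_cpow (by positivity)]
    push_cast
    rw [neg_neg]
  rw [hc] at h
  convert h using 2
  · ext w
    rw [← Complex.exp_add, linePoint]
    congr 1
    ring_nf
    rw [I_sq]
    ring
  · congr 1
    push_cast
    field_simp
    rw [I_sq]
    ring

theorem det_one_add_conj {N : ℕ} {S U : Matrix (Fin N) (Fin N) ℝ} {d : Fin N → ℝ}
    (hU : Uᵀ * U = 1) (hS : S = U * diagonal d * Uᵀ) : (1 + S).det = ∏ i, (1 + d i) := by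
  have h : 1 + S = U * diagonal (fun i => 1 + d i) * Uᵀ := by
    rw [hS, ← diagonal_add, diagonal_one, mul_add, add_mul, mul_one, mul_eq_one_comm.mp hU]
  rw [h, mul_assoc, det_mul_comm, mul_assoc, hU, mul_one, det_diagonal]

theorem mul_inv_one_add_conj {N : ℕ} {S U : Matrix (Fin N) (Fin N) ℝ} {d : Fin N → ℝ}
    (hU : Uᵀ * U = 1) (hS : S = U * diagonal d * Uᵀ) (hd : ∀ i, 0 < 1 + d i) :
    S * (1 + S)⁻¹ = U * diagonal (fun i => d i / (1 + d i)) * Uᵀ := by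
  have hdet : IsUnit (1 + S).det := by
    rw [det_one_add_conj hU hS]
    exact (Finset.prod_pos fun i _ => hd i).ne'.isUnit
  have h : 1 + S = U * diagonal (fun i => 1 + d i) * Uᵀ := by
    rw [hS, ← diagonal_add, diagonal_one, mul_add, add_mul, mul_one, mul_eq_one_comm.mp hU]
  have hm : U * diagonal (fun i => d i / (1 + d i)) * Uᵀ * (1 + S) = S := by
    rw [h, show ∀ A B : Matrix (Fin N) (Fin N) ℝ,
      U * A * Uᵀ * (U * B * Uᵀ) = U * (A * (Uᵀ * U) * B) * Uᵀ by
        intro A B; simp only [Matrix.mul_assoc], hU, mul_one, diagonal_mul_diagonal, hS]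
    congr 3
    ext i
    exact div_mul_cancel₀ _ (hd i).ne'
  rw [← mul_nonsing_inv_cancel_right _ (U * diagonal (fun i => d i / (1 + d i)) * Uᵀ) hdet, hm]

/-- In the orthonormal eigenbasis of `S` the integral splits into the one-dimensional integrals of
`integral_cexp_linePoint_sq`. -/
theorem integral_cexp_quadratic_form {N : ℕ} {S U : Matrix (Fin N) (Fin N) ℝ} {d : Fin N → ℝ}
    (hU : Uᵀ * U = 1) (hS : S = U * diagonal d * Uᵀ) (hd : ∀ i, 0 < 1 + d i) (X : Fin N → ℂ) :
    ∫ y : Fin N → ℝ, cexp ((∑ i, ∑ j, (S i j : ℂ) *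
        (linePoint (X i) (y i) * linePoint (X j) (y j))) / 4) * ∏ i, cexp (-(y i : ℂ) ^ 2) =
      (√Real.pi : ℝ) ^ N * ((((1 + S).det ^ (-(1 / 2) : ℝ) : ℝ) : ℂ) *
        cexp (X ⬝ᵥ (((S * (1 + S)⁻¹).map (fun r : ℝ => (r : ℂ))) *ᵥ X))) := by
  set UC : Matrix (Fin N) (Fin N) ℂ := U.map ofRealHom with hUC
  set V : Fin N → ℂ := UCᵀ *ᵥ X with hV
  have hUC' : UCᵀ * UC = 1 := by
    rw [hUC, ← transpose_map, ← Matrix.map_mul, hU]; simp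
  have hX : X = UC *ᵥ V := by
    rw [hV, mulVec_mulVec, mul_eq_one_comm.mp hUC', one_mulVec]
  have hdiag (e : Fin N → ℝ) (v : Fin N → ℂ) :
      (UC *ᵥ v) ⬝ᵥ ((U * diagonal e * Uᵀ).map ofRealHom *ᵥ (UC *ᵥ v)) =
        ∑ i, (e i : ℂ) * v i ^ 2 := by
    rw [dotProduct_mulVec_conj, Matrix.map_mul, Matrix.map_mul, transpose_map, ← hUC,
      show ∀ A : Matrix (Fin N) (Fin N) ℂ,
        UCᵀ * (UC * A * UCᵀ) * UC = (UCᵀ * UC) * A * (UCᵀ * UC) by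
          intro A; simp only [Matrix.mul_assoc], hUC', one_mul, mul_one,
      diagonal_map (map_zero _), dotProduct_diagonal_mulVec]
    rfl
  have hline (w : Fin N → ℝ) : (fun i => linePoint (X i) ((U *ᵥ w) i)) =
      UC *ᵥ fun i => linePoint (V i) (w i) := by
    have h1 : (fun i => linePoint (V i) (w i)) = (2 : ℂ) • (V + I • fun i => (w i : ℂ)) := by
      ext i; simp [linePoint]
    rw [h1, mulVec_smul, mulVec_add, mulVec_smul, ← hX]
    ext i
    simp [linePoint, mulVec, dotProduct, hUC]
  have hquad (w : Fin N → ℝ) : ∑ i, ∑ j, (S i j : ℂ) *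
      (linePoint (X i) ((U *ᵥ w) i) * linePoint (X j) ((U *ᵥ w) j)) =
        ∑ i, (d i : ℂ) * linePoint (V i) (w i) ^ 2 := by
    rw [← hdiag, ← hS, ← hline]
    simp only [dotProduct, mulVec, Finset.mul_sum, map_apply, ofRealHom_eq_coe]
    exact Finset.sum_congr rfl fun i _ => Finset.sum_congr rfl fun j _ => by ring
  have hnorm (w : Fin N → ℝ) : ∑ i, (U *ᵥ w) i ^ 2 = ∑ i, w i ^ 2 := by
    have h := dotProduct_mulVec_conj 1 U w
    rw [mul_one, hU, one_mulVec, one_mulVec] at h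
    simpa [dotProduct, pow_two] using h
  have hrot (w : Fin N → ℝ) : cexp ((∑ i, ∑ j, (S i j : ℂ) *
        (linePoint (X i) ((U *ᵥ w) i) * linePoint (X j) ((U *ᵥ w) j))) / 4) *
          ∏ i, cexp (-((U *ᵥ w) i : ℂ) ^ 2) =
      ∏ i, (cexp (d i * linePoint (V i) (w i) ^ 2 / 4) * cexp (-(w i : ℂ) ^ 2)) := by
    rw [hquad, Finset.prod_mul_distrib, Finset.sum_div, Complex.exp_sum]
    congr 1
    rw [← Complex.exp_sum, ← Complex.exp_sum, Finset.sum_neg_distrib, Finset.sum_neg_distrib]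
    congr 2
    exact_mod_cast hnorm w
  have hmp := measurePreserving_mulVec_of_orthogonal hU
  rw [← hmp.map_eq, integral_map hmp.measurable.aemeasurable
    (Continuous.aestronglyMeasurable (by fun_prop))]
  simp only [hrot]
  rw [integral_fintype_prod_volume_eq_prod
    (fun i w => cexp (d i * linePoint (V i) w ^ 2 / 4) * cexp (-(w : ℂ) ^ 2))]
  simp only [integral_cexp_linePoint_sq (hd _), Finset.prod_mul_distrib, Finset.prod_const,
    Finset.card_univ, Fintype.card_fin, ← Complex.exp_sum]
  have he : X ⬝ᵥ (((S * (1 + S)⁻¹).map (fun r : ℝ => (r : ℂ))) *ᵥ X) =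
      ∑ i, ((d i / (1 + d i) : ℝ) : ℂ) * V i ^ 2 := by
    rw [mul_inv_one_add_conj hU hS hd, ← hdiag, ← hX]
    rfl
  rw [he, det_one_add_conj hU hS, ← Real.finsetProd_rpow _ _ fun i _ => (hd i).le, mul_assoc]
  push_cast
  rfl

/-! ### Products over index pairs -/

@[to_additive]
theorem prod_upperPair {N : ℕ} {M : Type*} [CommMonoid M] (f : Fin N → Fin N → M) :
    ∏ p : UpperPair N, f p.1.1 p.1.2 = ∏ i, ∏ j, if i ≤ j then f i j else 1 := by
  rw [← Fintype.prod_prod_type' (f := fun i j => if i ≤ j then f i j else 1),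
    Finset.prod_ite, Finset.prod_const_one, mul_one]
  exact (Finset.prod_subtype _ (by simp) fun p : Fin N × Fin N => f p.1 p.2).symm

/-- Both orderings of every pair `i ≤ j` together run through all pairs, and twice through the
diagonal. -/
@[to_additive]
theorem prod_upperPair_mul_swap {N : ℕ} {M : Type*} [CommMonoid M] (f : Fin N → Fin N → M) :
    ∏ p : UpperPair N, (f p.1.1 p.1.2 * f p.1.2 p.1.1) = ∏ i, (f i i * ∏ j, f i j) := by
  rw [Finset.prod_mul_distrib, prod_upperPair f, prod_upperPair fun i j => f j i,
    Finset.prod_comm (f := fun i j => if i ≤ j then f j i else 1), ← Finset.prod_mul_distrib]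
  refine Finset.prod_congr rfl fun i _ => ?_
  have hi : f i i = ∏ j, if i = j then f i j else 1 := by simp
  rw [hi, ← Finset.prod_mul_distrib, ← Finset.prod_mul_distrib]
  refine Finset.prod_congr rfl fun j _ => ?_
  rcases lt_trichotomy i j with h | rfl | h
  · simp [h.le, h.ne, h.not_ge]
  · simp
  · simp [h.le, h.ne', h.not_ge]

@[to_additive]
theorem prod_upperPair_diag {N : ℕ} {M : Type*} [CommMonoid M] (f : Fin N → M) :
    ∏ p : UpperPair N, (if p.1.1 = p.1.2 then f p.1.1 else 1) = ∏ i, f i := by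
  rw [prod_upperPair fun i j => if i = j then f i else 1]
  refine Finset.prod_congr rfl fun i _ => ?_
  rw [Finset.prod_eq_single i] <;> aesop

/-! ### Termwise integration of the exponential series -/

/-- Halving the weight of the diagonal turns a sum over pairs `i ≤ j` into a sum over all pairs. -/
theorem sum_upperPair_weight_mul {N : ℕ} {𝕜 : Type*} [Field 𝕜] [CharZero 𝕜]
    (f : Fin N → Fin N → 𝕜) (hf : ∀ i j, f i j = f j i) :
    ∑ p : UpperPair N, (if p.1.1 = p.1.2 then 1 / 4 else 1 / 2) * f p.1.1 p.1.2 =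
      (∑ i, ∑ j, f i j) / 4 := by
  have h1 := sum_upperPair_add_swap f
  rw [Finset.sum_add_distrib (f := fun i => f i i), ← sum_upperPair_diag (fun i => f i i),
    ← sub_eq_iff_eq_add', ← Finset.sum_sub_distrib] at h1
  rw [← h1, Finset.sum_div]
  refine Finset.sum_congr rfl fun p _ => ?_
  rw [← hf p.1.1]
  split_ifs with h
  · rw [h]; ring
  · ring

/-- The summand of `(1 / 4) * ∑ i, ∑ j, S i j * z i * z j` that belongs to an index pair, where
`z i = linePoint (X i) (y i)`: an off-diagonal pair stands for two equal entries of `S`. -/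
noncomputable def pairExponent {N : ℕ} (S : Matrix (Fin N) (Fin N) ℝ) (X : Fin N → ℂ)
    (y : Fin N → ℝ) (p : UpperPair N) : ℂ :=
  (if p.1.1 = p.1.2 then 1 / 4 else 1 / 2) *
    (S p.1.1 p.1.2 * (linePoint (X p.1.1) (y p.1.1) * linePoint (X p.1.2) (y p.1.2)))

@[fun_prop]
theorem continuous_pairExponent {N : ℕ} (S : Matrix (Fin N) (Fin N) ℝ) (X : Fin N → ℂ)
    (p : UpperPair N) : Continuous fun y => pairExponent S X y p := by
  unfold pairExponent; fun_prop

theorem sum_pairExponent {N : ℕ} {S : Matrix (Fin N) (Fin N) ℝ} (hS : S.IsSymm)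
    (X : Fin N → ℂ) (y : Fin N → ℝ) :
    ∑ p, pairExponent S X y p =
      (∑ i, ∑ j, (S i j : ℂ) * (linePoint (X i) (y i) * linePoint (X j) (y j))) / 4 :=
  sum_upperPair_weight_mul
    (fun i j => (S i j : ℂ) * (linePoint (X i) (y i) * linePoint (X j) (y j)))
    fun i j => by rw [hS.apply, mul_comm (linePoint (X i) (y i))]

theorem sum_norm_pairExponent_le {N : ℕ} {S : Matrix (Fin N) (Fin N) ℝ} (hS : S.IsSymm)
    (X : Fin N → ℂ) (y : Fin N → ℝ) :
    ∑ p, ‖pairExponent S X y p‖ ≤ ∑ i, ‖S‖ * (‖X i‖ + |y i|) ^ 2 := by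
  have h1 : ∑ p, ‖pairExponent S X y p‖ =
      (∑ i, ∑ j, |S i j| * (‖linePoint (X i) (y i)‖ * ‖linePoint (X j) (y j)‖)) / 4 := by
    rw [← sum_upperPair_weight_mul]
    · refine Finset.sum_congr rfl fun p _ => ?_
      rw [pairExponent, norm_mul, norm_mul, norm_mul, norm_real, Real.norm_eq_abs]
      split_ifs <;> norm_num
    · intro i j
      rw [hS.apply, mul_comm ‖linePoint (X i) (y i)‖]
  have h2 := sum_abs_mul_le_norm S fun i => ‖linePoint (X i) (y i)‖
  have h3 : ∑ i, ‖linePoint (X i) (y i)‖ ^ 2 ≤ ∑ i, 4 * (‖X i‖ + |y i|) ^ 2 :=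
    Finset.sum_le_sum fun i _ => by
      calc _ ≤ (2 * (‖X i‖ + |y i|)) ^ 2 := by gcongr; exact norm_linePoint_le _ _
        _ = _ := by ring
  rw [← Finset.mul_sum] at h3 ⊢
  rw [h1]
  nlinarith [mul_le_mul_of_nonneg_left h3 (norm_nonneg S)]

/-- The row degrees count how often each variable occurs in the pairs, a diagonal pair
contributing two occurrences. -/
theorem prod_pow_rowDegree_symMatrix {N : ℕ} {R : Type*} [CommMonoid R] (z : Fin N → R)
    (k : UpperPair N → ℕ) :
    ∏ l, z l ^ rowDegree (symMatrix k) l =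
      ∏ p : UpperPair N, (z p.1.1 * z p.1.2) ^ k p := by
  have h := prod_upperPair_mul_swap fun i j => z i ^ symMatrix k i j
  simp only [rowDegree, pow_add, ← Finset.prod_pow_eq_pow_sum]
  rw [← h]
  refine Finset.prod_congr rfl fun ⟨⟨m, n⟩, hp⟩ _ => ?_
  have h1 : symMatrix k m n = k ⟨(m, n), hp⟩ := by
    simp only [symMatrix, Matrix.of_apply]
    rw [dif_pos hp]
  have h2 : symMatrix k n m = k ⟨(m, n), hp⟩ := by
    simp only [symMatrix, Matrix.of_apply]
    split_ifs with h
    · obtain rfl : m = n := le_antisymm hp h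
      rfl
    · rfl
  simp only [h1, h2, mul_pow]

theorem pow_trace_symMatrix {N : ℕ} {R : Type*} [CommMonoid R] (b : R) (k : UpperPair N → ℕ) :
    b ^ (symMatrix k).trace = ∏ p : UpperPair N, if p.1.1 = p.1.2 then b ^ k p else 1 := by
  rw [Matrix.trace, ← Finset.prod_pow_eq_pow_sum,
    ← prod_upperPair_diag fun i => b ^ (symMatrix k).diag i]
  refine Finset.prod_congr rfl fun ⟨⟨m, n⟩, hp⟩ _ => ?_
  split_ifs with h
  · obtain rfl : m = n := h
    simp [symMatrix]
  · rfl

/-- Each term of the Hermite series is a Gaussian average of a term of the multinomial expansion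
of `exp (∑ p, pairExponent S X y p)`. -/
theorem integral_prod_pairExponent_pow {N : ℕ} (S : Matrix (Fin N) (Fin N) ℝ) (X : Fin N → ℂ)
    (k : UpperPair N → ℕ) :
    ∫ y : Fin N → ℝ, (∏ p, pairExponent S X y p ^ k p / (k p).factorial) *
        ∏ l, cexp (-(y l : ℂ) ^ 2) =
      (√Real.pi : ℝ) ^ N * term S X k := by
  have h (y : Fin N → ℝ) : (∏ p, pairExponent S X y p ^ k p / ((k p).factorial : ℂ)) *
        ∏ l, cexp (-(y l : ℂ) ^ 2) =
      ((∏ p : UpperPair N,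
        (S p.1.1 p.1.2 : ℂ) ^ k p / ((2 : ℂ) ^ k p * (Nat.factorial (k p) : ℂ))) *
      ((2 : ℂ) ^ (symMatrix k).trace)⁻¹) *
        ∏ l, (linePoint (X l) (y l) ^ rowDegree (symMatrix k) l * cexp (-(y l : ℂ) ^ 2)) := by
    rw [Finset.prod_mul_distrib, ← mul_assoc, prod_pow_rowDegree_symMatrix, pow_trace_symMatrix,
      ← Finset.prod_inv_distrib, ← Finset.prod_mul_distrib, ← Finset.prod_mul_distrib]
    congr 1
    refine Finset.prod_congr rfl fun p _ => ?_
    rw [pairExponent]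
    split_ifs
    · rw [mul_pow, mul_pow, div_pow, one_pow, show (4 : ℂ) = 2 * 2 by norm_num, mul_pow]
      field_simp
    · rw [mul_pow, mul_pow, div_pow, one_pow]
      field_simp
  simp only [h]
  rw [integral_const_mul, integral_fintype_prod_volume_eq_prod
    (fun l t => linePoint (X l) t ^ rowDegree (symMatrix k) l * cexp (-(t : ℂ) ^ 2))]
  simp only [integral_linePoint_pow, Finset.prod_mul_distrib, Finset.prod_const,
    Finset.card_univ, Fintype.card_fin]
  rw [term]
  ring

/-- The bound that dominates all partial sums of the series; its one-variable factors are
integrable exactly because the coefficient `r` of `|y l| ^ 2` is below `1`. -/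
theorem integrable_dominating {N : ℕ} {r : ℝ} (hr : r < 1) (a : Fin N → ℝ) :
    Integrable fun y : Fin N → ℝ =>
      ∏ l, (Real.exp (r * (a l + |y l|) ^ 2) * Real.exp (-(y l) ^ 2)) := by
  refine Integrable.fintype_prod
    (f := fun l t => Real.exp (r * (a l + |t|) ^ 2) * Real.exp (-t ^ 2)) fun l => ?_
  refine (integrable_exp_neg_mul_sq_add_mul_abs (sub_pos.mpr hr) (2 * r * a l)
    (r * a l ^ 2)).congr (.of_forall fun t => ?_)
  simp only [← Real.exp_add]
  congr 1
  rw [add_sq, sq_abs]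
  ring

theorem hasSum_prod_norm_pow_div_factorial {ι : Type*} [Fintype ι] (a : ι → ℂ) :
    HasSum (fun k : ι → ℕ => ‖∏ i, a i ^ k i / ((k i).factorial : ℂ)‖)
      (Real.exp (∑ i, ‖a i‖)) := by
  have h := hasSum_prod_pow_div_factorial fun i => (‖a i‖ : ℂ)
  rw [← Complex.hasSum_ofReal]
  convert! h using 1
  · ext k
    simp
  · simp

theorem norm_prod_cexp_neg_sq {N : ℕ} (y : Fin N → ℝ) :
    ‖∏ l, cexp (-(y l : ℂ) ^ 2)‖ = ∏ l, Real.exp (-(y l) ^ 2) := by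
  rw [norm_prod]
  refine Finset.prod_congr rfl fun l _ => ?_
  rw [norm_exp]
  norm_cast

/-- Summation and Gaussian integration may be exchanged: the series of norms sums to
`exp (∑ p, ‖pairExponent S X y p‖ - ∑ l, y l ^ 2)`, which is integrable as `‖S‖ < 1`. -/
theorem hasSum_integral_prod_pairExponent {N : ℕ} {S : Matrix (Fin N) (Fin N) ℝ}
    (hS : S.IsSymm) (hnorm : ‖S‖ < 1) (X : Fin N → ℂ) :
    HasSum (fun k : UpperPair N → ℕ =>
        ∫ y : Fin N → ℝ, (∏ p, pairExponent S X y p ^ k p / (k p).factorial) *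
          ∏ l, cexp (-(y l : ℂ) ^ 2))
      (∫ y : Fin N → ℝ, cexp (∑ p, pairExponent S X y p) * ∏ l, cexp (-(y l : ℂ) ^ 2)) := by
  have hb (y : Fin N → ℝ) : HasSum (fun k : UpperPair N → ℕ =>
      ‖(∏ p, pairExponent S X y p ^ k p / ((k p).factorial : ℂ)) *
        ∏ l, cexp (-(y l : ℂ) ^ 2)‖)
      (Real.exp (∑ p, ‖pairExponent S X y p‖) * ∏ l, Real.exp (-(y l) ^ 2)) := by
    simp only [norm_mul, norm_prod_cexp_neg_sq]
    exact (hasSum_prod_norm_pow_div_factorial _).mul_right _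
  refine hasSum_integral_of_dominated_convergence
    (fun k y => ‖(∏ p, pairExponent S X y p ^ k p / ((k p).factorial : ℂ)) *
        ∏ l, cexp (-(y l : ℂ) ^ 2)‖)
    (fun k => Continuous.aestronglyMeasurable (by fun_prop))
    (fun k => .of_forall fun y => le_rfl) (.of_forall fun y => (hb y).summable) ?_
    (.of_forall fun y => (hasSum_prod_pow_div_factorial _).mul_right _)
  simp only [(hb _).tsum_eq]
  refine (integrable_dominating hnorm fun l => ‖X l‖).mono'
    (Continuous.aestronglyMeasurable (by fun_prop)) (.of_forall fun y => ?_)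
  rw [Real.norm_of_nonneg (by positivity), Finset.prod_mul_distrib]
  refine mul_le_mul_of_nonneg_right ?_ (by positivity)
  exact (Real.exp_le_exp.mpr (sum_norm_pairExponent_le hS X y)).trans_eq (Real.exp_sum _ _)

end KibbleSlepian

open KibbleSlepian in
theorem theorem1p1 (N : ℕ) (S : Matrix (Fin N) (Fin N) ℝ) (hsymm : S.IsSymm)
    (hnorm : ‖S‖ < 1) (X : Fin N → ℂ) :
    0 < (1 + S).det ∧
      HasSum (fun k : KibbleSlepian.UpperPair N → ℕ => KibbleSlepian.term S X k)
        ((((1 + S).det ^ (-(1 / 2) : ℝ) : ℝ) : ℂ) *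
          Complex.exp
            (dotProduct X (((S * (1 + S)⁻¹).map (fun r : ℝ => (r : ℂ))).mulVec X))) := by
  obtain ⟨U, d, hU, hS⟩ := exists_orthogonal_diagonalization hsymm
  have hd (i : Fin N) : 0 < 1 + d i := by
    have := (abs_le.mp (abs_diagonal_le_norm hU hS i)).1
    linarith
  refine ⟨det_one_add_conj hU hS ▸ Finset.prod_pos fun i _ => hd i, ?_⟩
  have h := hasSum_integral_prod_pairExponent hsymm hnorm X
  simp only [integral_prod_pairExponent_pow, sum_pairExponent hsymm,
    integral_cexp_quadratic_form hU hS hd] at h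
  have hpi : ((√Real.pi : ℝ) : ℂ) ^ N ≠ 0 :=
    pow_ne_zero _ (Complex.ofReal_ne_zero.mpr (Real.sqrt_pos.mpr Real.pi_pos).ne')
  exact (hasSum_mul_left_iff hpi).mp h
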